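/- Let $T$ be a simplicial triangulation of a closed connected surface, with vertex set $V$, edge set $E$ and set of triangles $F$. A PL metric on $T$ is an assignment of positive edge lengths satisfying the strict triangle inequalities on every triangle; $T$ is Delaunay for it if the two Euclidean angles facing each edge add up to at most $\pi$, and strictly Delaunay if they always add up to less than $\pi$. The dual (Voronoi) graph $T^*$ has the triangles of $T$ as its vertices, two of them being adjacent when they share an edge. Say that a finite graph $G=(V_G,E_G)$ satisfies the density condition if $$\frac{|E_G(\Omega)|}{|\Omega|}<\frac{|E_G|}{|V_G|}\qquad\text{for every }\emptyset\ne\Omega\subsetneq V_G,$$ where $E_G(\Omega)$ is the edge set of the subgraph induced by $\Omega$, and that $T$ satisfies Luo's condition if $$\frac{|F_I|}{|I|}>\frac{|F|}{|V|}\qquad\text{for every }\emptyset\ne I\subsetneq V,$$ where $F_I$ is the set of triangles having a vertex in $I$. Then the density condition on the dual graph is less restrictive than Luo's condition on the triangulation, in the following sense. (1) If $T$ is Delaunay for some PL metric and every vertex of $T$ has degree greater than $5$, then $T^*$ is connected and $3$-regular and satisfies the density condition; if moreover the surface is orientable, then $T^*$ has girth greater than $5$. (2) Luo's condition need not hold in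 the situation of (1): there are a triangulation $T$ of a closed connected orientable surface with all vertex degrees greater than $5$ and a PL metric for which $T$ is strictly Delaunay, such that $T^*$ satisfies the density condition and $T$ does not satisfy Luo's condition. (3) If $T$ is Delaunay for some PL metric and every vertex of $T$ has degree $6$, then $|V|-|E|+|F|=0$ (so the surface is a torus if it is orientable), $T$ satisfies Luo's condition, and $T^*$ satisfies the density condition. Such triangulations exist: there is a $6$-regular triangulation of a closed connected orientable surface that is strictly Delaunay for some PL metric. -/

import Mathlib

universe u

/-- A (simplicial) triangulation of a closed connected surface with vertex set `V`, given by its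
triangles: every vertex lies on a triangle, every edge lies on exactly two triangles, the link of
every vertex is connected (hence it is a single cycle), and the surface is connected. -/
structure SurfaceTriangulation (V : Type u) [Fintype V] [DecidableEq V] where
  /-- the set of triangles -/
  faces : Finset (Finset V)
  card_face : ∀ t ∈ faces, t.card = 3
  exists_face : ∀ v : V, ∃ t ∈ faces, v ∈ t
  card_faces_of_edge : ∀ t ∈ faces, ∀ e ⊆ t, e.card = 2 → (faces.filter (fun s => e ⊆ s)).card = 2
  /-- Any two vertices of the link of `v` are joined by a path in the link of `v`, where `x`, `y` are
  adjacent in the link of `v` when `{v, x, y}` is a triangle. -/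
  link_connected : ∀ v a b : V, a ≠ v → b ≠ v →
    (∃ t ∈ faces, v ∈ t ∧ a ∈ t) → (∃ t ∈ faces, v ∈ t ∧ b ∈ t) →
      Relation.ReflTransGen (fun x y : V => ({v, x, y} : Finset V) ∈ faces) a b
  /-- The vertex set is nonempty, -/
  nonempty : Nonempty V
  /-- and any two vertices are joined by an edge path. -/
  connected : ∀ a b : V, Relation.ReflTransGen (fun x y : V => ∃ t ∈ faces, x ∈ t ∧ y ∈ t) a b

namespace SurfaceTriangulation

variable {V : Type u} [Fintype V] [DecidableEq V]

/-- The 1-skeleton of the triangulation. -/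
def oneSkeleton (T : SurfaceTriangulation V) : SimpleGraph V where
  Adj a b := a ≠ b ∧ ∃ t ∈ T.faces, a ∈ t ∧ b ∈ t
  symm := ⟨fun _ _ h => ⟨h.1.symm, h.2.imp fun _ ht => ⟨ht.1, ht.2.2, ht.2.1⟩⟩⟩
  loopless := ⟨fun _ h => h.1 rfl⟩

instance (T : SurfaceTriangulation V) : DecidableRel T.oneSkeleton.Adj := fun a b =>
  inferInstanceAs (Decidable (a ≠ b ∧ ∃ t ∈ T.faces, a ∈ t ∧ b ∈ t))

/-- The dual graph: its vertices are the triangles, and two triangles are adjacent when they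
share an edge. -/
def dualGraph (T : SurfaceTriangulation V) : SimpleGraph {t : Finset V // t ∈ T.faces} where
  Adj s t := s ≠ t ∧ (s.1 ∩ t.1).card = 2
  symm := ⟨fun _ _ h => ⟨h.1.symm, by rw [Finset.inter_comm]; exact h.2⟩⟩
  loopless := ⟨fun _ h => h.1 rfl⟩

instance (T : SurfaceTriangulation V) : DecidableRel T.dualGraph.Adj := fun s t =>
  inferInstanceAs (Decidable (s ≠ t ∧ (s.1 ∩ t.1).card = 2))

/-- The Euler characteristic `|V| - |E| + |F|`. -/
def eulerChar (T : SurfaceTriangulation V) : ℤ :=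
  (Fintype.card V : ℤ) - (T.oneSkeleton.edgeFinset.card : ℤ) + (T.faces.card : ℤ)

/-- Orientability: every triangle can be given one of its two cyclic orders (`o a b c` says that
`a → b → c → a` is the chosen one) so that two triangles sharing an edge induce opposite
directions on it. -/
def IsOrientable (T : SurfaceTriangulation V) : Prop :=
  ∃ o : V → V → V → Prop,
    (∀ a b c, o a b c → o b c a) ∧
    (∀ a b c, {a, b, c} ∈ T.faces → (o a b c ↔ ¬ o b a c)) ∧
    (∀ a b c d, c ≠ d → {a, b, c} ∈ T.faces → {a, b, d} ∈ T.faces → (o a b c ↔ o b a d))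

/-- A piecewise linear metric on the triangulated surface: an assignment of positive edge lengths
that satisfies the strict triangle inequalities on every triangle. -/
structure PLMetric (T : SurfaceTriangulation V) where
  length : Sym2 V → ℝ
  length_pos : ∀ a b, T.oneSkeleton.Adj a b → 0 < length s(a, b)
  triangle : ∀ a b c, {a, b, c} ∈ T.faces →
    length s(a, b) < length s(b, c) + length s(a, c)

/-- The angle at `c` of the Euclidean triangle `a b c`, by the law of cosines. -/
noncomputable def PLMetric.angle {T : SurfaceTriangulation V} (l : T.PLMetric) (a b c : V) : ℝ :=
  Real.arccos ((l.length s(a, c) ^ 2 + l.length s(b, c) ^ 2 - l.length s(a, b) ^ 2) /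
    (2 * l.length s(a, c) * l.length s(b, c)))

/-- The triangulation is Delaunay for the PL metric: the two angles facing any edge `a b` add up to
at most `π`. -/
def PLMetric.IsDelaunay {T : SurfaceTriangulation V} (l : T.PLMetric) : Prop :=
  ∀ a b c d : V, c ≠ d → {a, b, c} ∈ T.faces → {a, b, d} ∈ T.faces →
    l.angle a b c + l.angle a b d ≤ Real.pi

/-- The triangulation is strictly Delaunay for the PL metric: the two angles facing any edge add up
to less than `π` (so that no two Voronoi vertices coincide). -/
def PLMetric.IsStrictlyDelaunay {T : SurfaceTriangulation V} (l : T.PLMetric) : Prop :=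
  ∀ a b c d : V, c ≠ d → {a, b, c} ∈ T.faces → {a, b, d} ∈ T.faces →
    l.angle a b c + l.angle a b d < Real.pi

/-- Luo's condition: `|F_I| / |I| > |F| / |V|` for every nonempty proper set `I` of vertices, where
`F_I` is the set of the triangles that have a vertex in `I`. -/
def LuoCondition (T : SurfaceTriangulation V) : Prop :=
  ∀ I : Finset V, I.Nonempty → I ≠ Finset.univ →
    ((T.faces.filter (fun t => (t ∩ I).Nonempty)).card : ℝ) / (I.card : ℝ) >
      (T.faces.card : ℝ) / (Fintype.card V : ℝ)

end SurfaceTriangulation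

/-- The density condition on a finite graph: `|E(Ω)| / |Ω| < |E| / |V|` for every nonempty proper
set `Ω` of vertices, where `E(Ω)` is the edge set of the subgraph induced by `Ω`. -/
def SimpleGraph.DensityCondition {W : Type u} [Fintype W] (G : SimpleGraph W) : Prop :=
  ∀ Ω : Finset W, Ω.Nonempty → Ω ≠ Finset.univ →
    ((G.induce (Ω : Set W)).edgeSet.ncard : ℝ) / (Ω.card : ℝ) <
      (G.edgeSet.ncard : ℝ) / (Fintype.card W : ℝ)

/-! The dual graph is 3-regular because each edge of a triangle lies on exactly one other triangle,
and connected because the vertex links and the surface are. In a connected d-regular graph some edge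
leaves every nonempty proper Ω, so 2|E(Ω)| < d|Ω|, while 2|E| = d|V|: this is the density condition.
Luo's condition for a regular triangulation comes from the same kind of count, applied to incidences
of vertices and triangles.

For the girth, a short dual cycle is a closed strip of k ≤ 5 triangles. An orientation separates its
two sides into closed walks whose lengths add up to k, so one has length at most 2. Length 0 means
that the strip circles a vertex of degree k; length 1 would be a loop; length 2 goes back and forth
along one edge and forces a vertex of degree at most 4 (`IsOrientation.not_closed_strip`).

Luo's condition fails after gluing in a seven-vertex torus minus a triangle: its 4 inner vertices
meet only 13 triangles, whereas |F|/|V| = 2 - 2χ/|V| exceeds 13/4 once -χ is large compared with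
|V|. The example has |V| = 17, χ = -12 and |F| = 58. Equilateral lengths make every triangulation
strictly Delaunay. -/

theorem Finset.exists_eq_triple_of_card_eq_three {α : Type*} [DecidableEq α] {t : Finset α}
    (ht : t.card = 3) {a b : α} (ha : a ∈ t) (hb : b ∈ t) (hab : a ≠ b) :
    ∃ c, c ≠ a ∧ c ≠ b ∧ t = {a, b, c} := by
  have h1 : ((t.erase a).erase b).card = 1 := by
    rw [Finset.card_erase_of_mem (Finset.mem_erase.2 ⟨hab.symm, hb⟩),
      Finset.card_erase_of_mem ha, ht]
  obtain ⟨c, hc⟩ := Finset.card_eq_one.1 h1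
  have hct : c ∈ (t.erase a).erase b := by rw [hc]; exact Finset.mem_singleton_self c
  simp only [Finset.mem_erase] at hct
  refine ⟨c, hct.2.1, hct.1, ?_⟩
  rw [← hc, Finset.insert_erase (Finset.mem_erase.2 ⟨hab.symm, hb⟩), Finset.insert_erase ha]

theorem Finset.ne_of_card_triple {α : Type*} [DecidableEq α] {a b c : α}
    (h : ({a, b, c} : Finset α).card = 3) : a ≠ b ∧ a ≠ c ∧ b ≠ c := by
  refine ⟨?_, ?_, ?_⟩ <;> rintro rfl
  · have := Finset.card_le_two (a := a) (b := c)
    simp at h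
    omega
  · have := Finset.card_le_two (a := b) (b := a)
    rw [Finset.pair_comm b a] at h
    simp at h
    rw [Finset.pair_comm] at this
    omega
  · have := Finset.card_le_two (a := a) (b := b)
    simp at h
    omega

/-! ### Density of connected regular graphs -/

namespace SimpleGraph

/-- A connected regular graph of positive degree satisfies the density condition. -/
theorem Connected.densityCondition_of_isRegularOfDegree {W : Type u} [Fintype W]
    {G : SimpleGraph W} [DecidableRel G.Adj] {d : ℕ}
    (hc : G.Connected) (hr : G.IsRegularOfDegree d) : G.DensityCondition := by
  classical
  intro Ω hne hun
  have hW : 0 < Fintype.card W := Fintype.card_pos_iff.2 ⟨hne.choose⟩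
  have hE : 2 * G.edgeSet.ncard = d * Fintype.card W := by
    have h := G.sum_degrees_eq_twice_card_edges
    rw [Finset.sum_congr rfl (fun v _ => hr v), Finset.sum_const, smul_eq_mul,
      Finset.card_univ] at h
    rw [← coe_edgeFinset, Set.ncard_coe_finset, ← h, mul_comm]
  let H := G.induce (Ω : Set W)
  have hdeg : ∀ v : (Ω : Set W), H.degree v = (G.neighborFinset v ∩ Ω).card := by
    intro v
    rw [← card_neighborFinset_eq_degree,
      ← Finset.card_map (Function.Embedding.subtype (fun x => x ∈ (Ω : Set W)))]
    congr 1
    ext x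
    simp [H]
  have hle : ∀ v : (Ω : Set W), H.degree v ≤ d := by
    intro v
    rw [hdeg, ← hr v]
    exact Finset.card_le_card Finset.inter_subset_left
  -- Connectedness gives an edge leaving Ω; its end in Ω loses degree in the induced graph, which
  -- makes the degree count strict.
  obtain ⟨a, ha, b, hb, hab⟩ : ∃ a ∈ Ω, ∃ b ∉ Ω, G.Adj a b := by
    obtain ⟨x, hx⟩ := hne
    obtain ⟨y, hy⟩ : ∃ y, y ∉ Ω := by
      by_contra! h
      exact hun (Finset.eq_univ_iff_forall.2 h)
    obtain ⟨w⟩ := hc.preconnected x y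
    obtain ⟨e, -, h1, h2⟩ := w.exists_boundary_dart (Ω : Set W) hx hy
    exact ⟨e.fst, h1, e.snd, h2, e.adj⟩
  have hlt : H.degree ⟨a, ha⟩ < d := by
    rw [hdeg, ← hr a]
    refine Finset.card_lt_card ⟨Finset.inter_subset_left, fun h => hb ?_⟩
    exact (Finset.mem_inter.1 (h ((G.mem_neighborFinset a b).2 hab))).2
  have hH : 2 * H.edgeSet.ncard < d * Ω.card := by
    have h := H.sum_degrees_eq_twice_card_edges
    rw [← coe_edgeFinset, Set.ncard_coe_finset, ← h]
    calc ∑ v, H.degree v < ∑ _v : (Ω : Set W), d :=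
          Finset.sum_lt_sum (fun v _ => hle v) ⟨⟨a, ha⟩, Finset.mem_univ _, hlt⟩
      _ = d * Ω.card := by simp [mul_comm]
  have hΩ : (0 : ℝ) < Ω.card := by exact_mod_cast hne.card_pos
  have hW' : (0 : ℝ) < Fintype.card W := by exact_mod_cast hW
  have hE' : 2 * (G.edgeSet.ncard : ℝ) = d * Fintype.card W := by exact_mod_cast hE
  have hH' : 2 * (H.edgeSet.ncard : ℝ) < d * Ω.card := by exact_mod_cast hH
  rw [div_lt_div_iff₀ hΩ hW']
  nlinarith

end SimpleGraph

/-! ### The dual graph is connected and 3-regular -/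

namespace SurfaceTriangulation

variable {V : Type u} [Fintype V] [DecidableEq V] (T : SurfaceTriangulation V)

theorem ne_of_mem_faces {a b c : V} (h : {a, b, c} ∈ T.faces) : a ≠ b ∧ a ≠ c ∧ b ≠ c :=
  Finset.ne_of_card_triple (T.card_face _ h)

theorem card_faces_of_adj {a b : V} (h : T.oneSkeleton.Adj a b) :
    (T.faces.filter (fun s => a ∈ s ∧ b ∈ s)).card = 2 := by
  obtain ⟨hab, t, ht, ha, hb⟩ := h
  rw [← T.card_faces_of_edge t ht {a, b} (by simp [Finset.insert_subset_iff, ha, hb])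
    (Finset.card_pair hab)]
  congr 1
  ext s
  simp [Finset.insert_subset_iff]

/-- The number of triangles at a vertex is its degree. -/
theorem card_faces_of_vertex (v : V) :
    (T.faces.filter (fun t => v ∈ t)).card = T.oneSkeleton.degree v := by
  rw [← SimpleGraph.card_neighborFinset_eq_degree]
  -- Each neighbour of v lies on two of the triangles at v, and each triangle at v contains two
  -- neighbours.
  have := Finset.card_mul_eq_card_mul (s := T.oneSkeleton.neighborFinset v)
    (t := T.faces.filter (fun t => v ∈ t)) (fun w t => w ∈ t) (m := 2) (n := 2) ?_ ?_
  · omega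
  · intro w hw
    rw [SimpleGraph.mem_neighborFinset] at hw
    rw [← T.card_faces_of_adj hw, Finset.bipartiteAbove, Finset.filter_filter]
  · intro t ht
    rw [Finset.mem_filter] at ht
    have h2 : (t.erase v).card = 2 := by
      rw [Finset.card_erase_of_mem ht.2, T.card_face t ht.1]
    rw [← h2, Finset.bipartiteBelow]
    congr 1
    ext w
    simp only [Finset.mem_filter, SimpleGraph.mem_neighborFinset, Finset.mem_erase]
    exact ⟨fun h => ⟨h.1.1.symm, h.2⟩, fun h => ⟨⟨h.1.symm, t, ht.1, ht.2, h.2⟩, h.2⟩⟩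

theorem card_inter_of_ne {s t : Finset V} (hs : s ∈ T.faces) (ht : t ∈ T.faces) (hst : s ≠ t)
    {e : Finset V} (hes : e ⊆ s) (het : e ⊆ t) (he : e.card = 2) : s ∩ t = e := by
  refine (Finset.eq_of_subset_of_card_le (Finset.subset_inter hes het) ?_).symm
  have h3 := T.card_face s hs
  have h3' := T.card_face t ht
  by_contra! h
  have h1 : s ∩ t = s :=
    Finset.eq_of_subset_of_card_le Finset.inter_subset_left (by omega)
  have h2 : s ∩ t = t :=
    Finset.eq_of_subset_of_card_le Finset.inter_subset_right (by omega)
  exact hst (h1.symm.trans h2)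

theorem dualGraph_adj_of_mem {s t : {t : Finset V // t ∈ T.faces}} (hst : s ≠ t) {a b : V}
    (hab : a ≠ b) (has : a ∈ s.1) (hbs : b ∈ s.1) (hat : a ∈ t.1) (hbt : b ∈ t.1) :
    T.dualGraph.Adj s t := by
  refine ⟨hst, ?_⟩
  rw [T.card_inter_of_ne s.2 t.2 (fun h => hst (Subtype.ext h)) (e := {a, b})
    (by simp [Finset.insert_subset_iff, has, hbs])
    (by simp [Finset.insert_subset_iff, hat, hbt]) (Finset.card_pair hab), Finset.card_pair hab]

theorem dualGraph_reachable_of_mem {s t : {t : Finset V // t ∈ T.faces}} {a b : V}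
    (hab : a ≠ b) (has : a ∈ s.1) (hbs : b ∈ s.1) (hat : a ∈ t.1) (hbt : b ∈ t.1) :
    T.dualGraph.Reachable s t := by
  by_cases hst : s = t
  · rw [hst]
  · exact (T.dualGraph_adj_of_mem hst hab has hbs hat hbt).reachable

theorem exists_ne_mem_face {t : Finset V} (ht : t ∈ T.faces) (v : V) : ∃ a ∈ t, a ≠ v := by
  by_contra! h
  have := Finset.card_le_card (show t ⊆ {v} from fun x hx => Finset.mem_singleton.2 (h x hx))
  rw [T.card_face t ht] at this
  simp at this

/-- A path in the link of v is a fan of triangles at v, consecutive ones sharing the edge from v to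
a vertex of the path. -/
theorem dualGraph_reachable_of_mem_vertex {s t : {t : Finset V // t ∈ T.faces}} {v : V}
    (hs : v ∈ s.1) (ht : v ∈ t.1) : T.dualGraph.Reachable s t := by
  obtain ⟨a, has, hav⟩ := T.exists_ne_mem_face s.2 v
  obtain ⟨b, hbt, hbv⟩ := T.exists_ne_mem_face t.2 v
  have key : ∀ y, Relation.ReflTransGen (fun x y : V => ({v, x, y} : Finset V) ∈ T.faces) a y →
      y ≠ v ∧ ∀ u : {t : Finset V // t ∈ T.faces}, v ∈ u.1 → y ∈ u.1 →
        T.dualGraph.Reachable s u := by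
    intro y hy
    induction hy with
    | refl => exact ⟨hav, fun u hv ha => T.dualGraph_reachable_of_mem hav has hs ha hv⟩
    | @tail x y _ hxy ih =>
      have hne := (T.ne_of_mem_faces hxy).2.1
      refine ⟨hne.symm, fun u hv hy => ?_⟩
      exact (ih.2 ⟨_, hxy⟩ (by simp) (by simp)).trans
        (T.dualGraph_reachable_of_mem hne (by simp) (by simp) hv hy)
  exact (key b (T.link_connected v a b hav hbv ⟨s.1, s.2, hs, has⟩ ⟨t.1, t.2, ht, hbt⟩)).2 t ht hbt

theorem dualGraph_connected : T.dualGraph.Connected := by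
  obtain ⟨v⟩ := T.nonempty
  obtain ⟨t₀, ht₀, hv⟩ := T.exists_face v
  have key : ∀ b, Relation.ReflTransGen (fun x y : V => ∃ t ∈ T.faces, x ∈ t ∧ y ∈ t) v b →
      ∀ u : {t : Finset V // t ∈ T.faces}, b ∈ u.1 → T.dualGraph.Reachable ⟨t₀, ht₀⟩ u := by
    intro b hb
    induction hb with
    | refl => exact fun u hu => T.dualGraph_reachable_of_mem_vertex hv hu
    | tail _ hxy ih =>
      obtain ⟨t, ht, hx, hy⟩ := hxy
      exact fun u hu => (ih ⟨t, ht⟩ hx).trans (T.dualGraph_reachable_of_mem_vertex hy hu)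
  have h0 : ∀ u, T.dualGraph.Reachable ⟨t₀, ht₀⟩ u := by
    intro u
    obtain ⟨b, hb, -⟩ := T.exists_ne_mem_face u.2 v
    exact key b (T.connected v b) u hb
  have : Nonempty {t : Finset V // t ∈ T.faces} := ⟨⟨t₀, ht₀⟩⟩
  exact SimpleGraph.Connected.mk fun u w => (h0 u).symm.trans (h0 w)

/-- At most two triangles contain a given edge. -/
theorem eq_of_edge_subset {s s' t e : Finset V} (hs : s ∈ T.faces) (hs' : s' ∈ T.faces)
    (ht : t ∈ T.faces) (he : e.card = 2) (hes : e ⊆ s) (hes' : e ⊆ s') (het : e ⊆ t)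
    (hst : s ≠ t) (hst' : s' ≠ t) : s = s' := by
  by_contra hne
  have h2 := T.card_faces_of_edge t ht e het he
  have h3 : ({s, s', t} : Finset (Finset V)).card = 3 := by
    rw [Finset.card_eq_three]
    exact ⟨s, s', t, hne, hst, hst', rfl⟩
  have := Finset.card_le_card (show ({s, s', t} : Finset (Finset V)) ⊆
    T.faces.filter (fun r => e ⊆ r) by
      simp [Finset.insert_subset_iff, hs, hs', ht, hes, hes', het])
  omega

/-- Intersecting with t is a bijection from the dual neighbours of t to its three edges, since each
edge lies on exactly one other triangle. -/
theorem dualGraph_isRegularOfDegree : T.dualGraph.IsRegularOfDegree 3 := by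
  intro t
  rw [← SimpleGraph.card_neighborFinset_eq_degree]
  have h3 : (t.1.powersetCard 2).card = 3 := by
    rw [Finset.card_powersetCard, T.card_face t.1 t.2]; rfl
  rw [← h3]
  refine Finset.card_bij (fun s _ => s.1 ∩ t.1) ?_ ?_ ?_
  · intro s hs
    rw [SimpleGraph.mem_neighborFinset] at hs
    exact Finset.mem_powersetCard.2 ⟨Finset.inter_subset_right, hs.symm.2⟩
  · intro s hs s' hs' h
    rw [SimpleGraph.mem_neighborFinset] at hs hs'
    refine Subtype.ext (T.eq_of_edge_subset s.2 s'.2 t.2 hs.symm.2 Finset.inter_subset_left ?_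
      Finset.inter_subset_right (fun h => hs.1 (Subtype.ext h.symm))
      (fun h => hs'.1 (Subtype.ext h.symm)))
    rw [h]
    exact Finset.inter_subset_left
  · intro e he
    obtain ⟨het, he2⟩ := Finset.mem_powersetCard.1 he
    have h2 := T.card_faces_of_edge t.1 t.2 e het he2
    obtain ⟨s, hs, hst⟩ := Finset.exists_mem_ne (by rw [h2]; exact one_lt_two) t.1
    rw [Finset.mem_filter] at hs
    have hi := T.card_inter_of_ne hs.1 t.2 hst hs.2 het he2
    refine ⟨⟨s, hs.1⟩, ?_, hi⟩
    rw [SimpleGraph.mem_neighborFinset]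
    exact SimpleGraph.Adj.symm ⟨fun h => hst (congrArg Subtype.val h), by rw [hi, he2]⟩

theorem dualGraph_densityCondition : T.dualGraph.DensityCondition :=
  T.dualGraph_connected.densityCondition_of_isRegularOfDegree
    T.dualGraph_isRegularOfDegree

/-! ### Incidence counts, Euler characteristic and Luo's condition -/

/-- Counting the incidences between a set of vertices and the triangles. -/
theorem sum_degree_eq_sum_card_inter (I : Finset V) :
    ∑ v ∈ I, T.oneSkeleton.degree v = ∑ t ∈ T.faces, (t ∩ I).card := by
  simp_rw [← T.card_faces_of_vertex]
  have := Finset.sum_card_bipartiteAbove_eq_sum_card_bipartiteBelow (s := I) (t := T.faces)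
    (fun v t => v ∈ t)
  simp only [Finset.bipartiteAbove, Finset.bipartiteBelow] at this
  rw [this]
  refine Finset.sum_congr rfl fun t _ => ?_
  congr 1
  ext v
  simp [and_comm]

theorem sum_degree_eq : ∑ v, T.oneSkeleton.degree v = 3 * T.faces.card := by
  rw [T.sum_degree_eq_sum_card_inter, Finset.sum_congr rfl
    (fun t ht => by rw [Finset.inter_univ, T.card_face t ht]), Finset.sum_const, smul_eq_mul,
    mul_comm]

/-- Both 3|F| and 2|E| equal the degree sum 6|V|. -/
theorem eulerChar_eq_zero_of_isRegularOfDegree_six (h : T.oneSkeleton.IsRegularOfDegree 6) :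
    T.eulerChar = 0 := by
  have h1 := T.sum_degree_eq
  have h2 := T.oneSkeleton.sum_degrees_eq_twice_card_edges
  rw [Finset.sum_congr rfl (fun v _ => h v), Finset.sum_const, smul_eq_mul,
    Finset.card_univ] at h1 h2
  unfold eulerChar
  omega

/-- Some triangle meets both a nonempty proper set of vertices and its complement. -/
theorem exists_face_crossing {I : Finset V} (hne : I.Nonempty) (hun : I ≠ Finset.univ) :
    ∃ t ∈ T.faces, (t ∩ I).Nonempty ∧ ¬ t ⊆ I := by
  by_contra! h
  obtain ⟨x, hx⟩ := hne
  refine hun (Finset.eq_univ_iff_forall.2 fun y => ?_)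
  induction T.connected x y with
  | refl => exact hx
  | tail _ hab ih =>
    obtain ⟨t, ht, ha, hb⟩ := hab
    exact h t ht ⟨_, Finset.mem_inter.2 ⟨ha, ih⟩⟩ hb

theorem luoCondition_of_isRegularOfDegree {d : ℕ} (h : T.oneSkeleton.IsRegularOfDegree d) :
    T.LuoCondition := by
  intro I hne hun
  have h1 := T.sum_degree_eq
  have h2 := T.sum_degree_eq_sum_card_inter I
  rw [Finset.sum_congr rfl (fun v _ => h v), Finset.sum_const, smul_eq_mul] at h1 h2
  rw [Finset.card_univ] at h1
  obtain ⟨t₀, ht₀, hI, hnot⟩ := T.exists_face_crossing hne hun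
  set FI := T.faces.filter (fun t => (t ∩ I).Nonempty) with hFI
  have h3 : ∑ t ∈ T.faces, (t ∩ I).card = ∑ t ∈ FI, (t ∩ I).card := by
    rw [hFI, Finset.sum_filter]
    refine Finset.sum_congr rfl fun t _ => ?_
    split_ifs with hh
    · rfl
    · rw [Finset.not_nonempty_iff_eq_empty.1 hh, Finset.card_empty]
  -- A triangle has at most three vertices in I, and the crossing triangle `t₀` has fewer.
  have h4 : I.card * d < 3 * FI.card := by
    rw [h2, h3, mul_comm, ← smul_eq_mul, ← Finset.sum_const]
    refine Finset.sum_lt_sum (fun t ht => ?_) ⟨t₀, Finset.mem_filter.2 ⟨ht₀, hI⟩, ?_⟩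
    · rw [← T.card_face t (Finset.mem_filter.1 ht).1]
      exact Finset.card_le_card Finset.inter_subset_left
    · rw [← T.card_face t₀ ht₀]
      exact Finset.card_lt_card ⟨Finset.inter_subset_left,
        fun hh => hnot (fun x hx => (Finset.mem_inter.1 (hh hx)).2)⟩
  have := T.nonempty
  have hV : (0 : ℝ) < Fintype.card V := by exact_mod_cast Fintype.card_pos
  have hI' : (0 : ℝ) < I.card := by exact_mod_cast hne.card_pos
  have h1' : (Fintype.card V : ℝ) * d = 3 * T.faces.card := by exact_mod_cast h1
  have h4' : (I.card : ℝ) * d < 3 * FI.card := by exact_mod_cast h4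
  rw [gt_iff_lt, div_lt_div_iff₀ hV hI']
  nlinarith

/-- The PL metric with all edges of length one. -/
def equilateral : T.PLMetric where
  length _ := 1
  length_pos _ _ _ := one_pos
  triangle _ _ _ _ := by norm_num

theorem equilateral_isStrictlyDelaunay : T.equilateral.IsStrictlyDelaunay := by
  intro a b c d _ _ _
  have h : ∀ a b c, T.equilateral.angle a b c < Real.pi / 2 := fun a b c => by
    rw [PLMetric.angle, Real.arccos_lt_pi_div_two]
    norm_num [equilateral]
  linarith [h a b c, h a b d]

end SurfaceTriangulation

/-! ### Orientations and turning about a vertex -/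

namespace SurfaceTriangulation

variable {V : Type u} [Fintype V] [DecidableEq V] (T : SurfaceTriangulation V)

/-- `O a b c` says that `a b c` is a positively oriented triangle, for a coherent orientation. -/
structure IsOrientation (O : V → V → V → Prop) : Prop where
  mem_faces : ∀ {a b c}, O a b c → {a, b, c} ∈ T.faces
  cyclic : ∀ {a b c}, O a b c → O b c a
  total : ∀ {a b c}, {a, b, c} ∈ T.faces → O a b c ∨ O b a c
  asymm : ∀ {a b c}, O a b c → ¬ O b a c
  unique : ∀ {a b c d}, O a b c → O a b d → c = d

variable {T}

/-- Restricting `o` to triangles turns coherence into `unique`: a directed edge determines its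
positive triangle. -/
theorem IsOrientable.exists_isOrientation (h : T.IsOrientable) : ∃ O, T.IsOrientation O := by
  obtain ⟨o, h1, h2, h3⟩ := h
  refine ⟨fun a b c => {a, b, c} ∈ T.faces ∧ o a b c, fun h => h.1, ?_, ?_, ?_, ?_⟩
  · rintro a b c ⟨h, ho⟩
    refine ⟨?_, h1 _ _ _ ho⟩
    rwa [Finset.pair_comm c a, Finset.insert_comm b a]
  · intro a b c h
    have h' : {b, a, c} ∈ T.faces := by rwa [Finset.insert_comm b a]
    have := h2 a b c h
    tauto
  · rintro a b c ⟨h, ho⟩ ⟨-, ho'⟩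
    exact (h2 a b c h).1 ho ho'
  · rintro a b c d ⟨h, ho⟩ ⟨h', ho'⟩
    by_contra hcd
    exact (h2 a b d h').1 ho' ((h3 a b c d hcd h h').1 ho)

namespace IsOrientation

variable {O : V → V → V → Prop} (hO : T.IsOrientation O)
include hO

/-- A nonempty set of neighbours of `v` that is closed under both rotations about `v` contains all
the neighbours. -/
theorem degree_le_card {v : V} {S : Finset V} (hne : S.Nonempty)
    (h1 : ∀ x ∈ S, ∃ y ∈ S, O x v y) (h2 : ∀ x ∈ S, ∃ y ∈ S, O y v x) :
    T.oneSkeleton.degree v ≤ S.card := by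
  rw [← SimpleGraph.card_neighborFinset_eq_degree]
  refine Finset.card_le_card fun b hb => ?_
  rw [SimpleGraph.mem_neighborFinset] at hb
  obtain ⟨a, ha⟩ := hne
  obtain ⟨y, -, hy⟩ := h1 a ha
  have hav := (T.ne_of_mem_faces (hO.mem_faces hy)).1
  induction T.link_connected v a b hav hb.1.symm ⟨_, hO.mem_faces hy, by simp, by simp⟩ hb.2 with
  | refl => exact ha
  | @tail x y _ hxy ih =>
    have hne := T.ne_of_mem_faces hxy
    have hxS : x ∈ S := ih ⟨hne.1, _, hxy, by simp, by simp⟩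
    rcases hO.total hxy with h | h
    · obtain ⟨z, hz, hzx⟩ := h2 x hxS
      rwa [hO.unique h (hO.cyclic hzx)]
    · obtain ⟨z, hz, hxz⟩ := h1 x hxS
      rwa [hO.unique h hxz]

/-- In this and the next three lemmas the triangles close up around v. The listed neighbours need
not be distinct, and the uniform bound 5 is all that the girth argument needs. -/
theorem degree_le_two {v a b : V} (h1 : O a v b) (h2 : O b v a) : T.oneSkeleton.degree v ≤ 5 :=
  (hO.degree_le_card (S := {a, b}) (by simp) (by simp [h1, h2]) (by simp [h1, h2])).trans
    (Finset.card_le_two.trans (by norm_num))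

theorem degree_le_three {v a b c : V} (h1 : O a v b) (h2 : O b v c) (h3 : O c v a) :
    T.oneSkeleton.degree v ≤ 5 :=
  (hO.degree_le_card (S := {a, b, c}) (by simp) (by simp [h1, h2, h3])
    (by simp [h1, h2, h3])).trans (Finset.card_le_three.trans (by norm_num))

theorem degree_le_four {v a b c d : V} (h1 : O a v b) (h2 : O b v c) (h3 : O c v d)
    (h4 : O d v a) : T.oneSkeleton.degree v ≤ 5 :=
  (hO.degree_le_card (S := {a, b, c, d}) (by simp) (by simp [h1, h2, h3, h4])
    (by simp [h1, h2, h3, h4])).trans (Finset.card_le_four.trans (by norm_num))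

theorem degree_le_five {v a b c d e : V} (h1 : O a v b) (h2 : O b v c) (h3 : O c v d)
    (h4 : O d v e) (h5 : O e v a) : T.oneSkeleton.degree v ≤ 5 :=
  (hO.degree_le_card (S := {a, b, c, d, e}) (by simp) (by simp [h1, h2, h3, h4, h5])
    (by simp [h1, h2, h3, h4, h5])).trans Finset.card_le_five

/-- Crossing from the triangle `t = a c x`, entered through the edge `a c` from `s`, to the next
triangle `u` of a path in the dual graph. -/
theorem exists_step {s t u : Finset V} (hs : s ∈ T.faces) (ht : t ∈ T.faces) (hu : u ∈ T.faces)
    (hst : s ≠ t) (hsu : s ≠ u) (htu : t ≠ u) (hadj : (t ∩ u).card = 2) {a c x : V}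
    (hacx : O a c x) (htt : t = {a, c, x}) (has : a ∈ s) (hcs : c ∈ s) :
    ∃ a' c' x', ((a' = x ∧ c' = c) ∨ (a' = a ∧ c' = x)) ∧ O a' c' x' ∧ u = {a', c', x'} ∧
      a' ∈ t ∧ c' ∈ t := by
  obtain ⟨hac, hax, hcx⟩ := T.ne_of_mem_faces (hO.mem_faces hacx)
  -- The direction q r already belongs to t, so u must induce the opposite one.
  have key : ∀ p q r, O p q r → t = {p, q, r} → q ∈ u → r ∈ u → ∃ y, O r q y ∧ u = {r, q, y} := by
    intro p q r hpqr htp hq hr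
    have hne := T.ne_of_mem_faces (hO.mem_faces hpqr)
    obtain ⟨y, -, -, hy⟩ :=
      Finset.exists_eq_triple_of_card_eq_three (T.card_face u hu) hr hq hne.2.2.symm
    refine ⟨y, ?_, hy⟩
    rcases hO.total (hy ▸ hu) with h | h
    · exact h
    · have := hO.unique h (hO.cyclic hpqr)
      subst this
      refine absurd ?_ htu
      rw [htp, hy]
      ext z
      simp only [Finset.mem_insert, Finset.mem_singleton]
      tauto
  -- Leaving through the entry edge would put three triangles s, t, u on it.
  have hnot : ¬ (a ∈ u ∧ c ∈ u) := by
    rintro ⟨ha, hc⟩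
    refine hsu (T.eq_of_edge_subset hs hu ht (Finset.card_pair hac) ?_ ?_ ?_ hst htu.symm)
    · simp [Finset.insert_subset_iff, has, hcs]
    · simp [Finset.insert_subset_iff, ha, hc]
    · simp [htt]
  have hcases : (c ∈ u ∧ x ∈ u) ∨ (a ∈ u ∧ x ∈ u) := by
    obtain ⟨p, q, hpq, hpq'⟩ := Finset.card_eq_two.1 hadj
    have hp : p ∈ t ∩ u := by simp [hpq']
    have hq : q ∈ t ∩ u := by simp [hpq']
    simp only [htt, Finset.mem_inter, Finset.mem_insert, Finset.mem_singleton] at hp hq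
    grind
  rcases hcases with ⟨hc, hx⟩ | ⟨ha, hx⟩
  · obtain ⟨y, hy, huy⟩ := key a c x hacx htt hc hx
    exact ⟨x, c, y, Or.inl ⟨rfl, rfl⟩, hy, huy, by simp [htt], by simp [htt]⟩
  · obtain ⟨y, hy, huy⟩ := key c x a (hO.cyclic hacx) (by
      rw [htt]; ext z; simp only [Finset.mem_insert, Finset.mem_singleton]; tauto) hx ha
    exact ⟨a, x, y, Or.inr ⟨rfl, rfl⟩, hy, huy, by simp [htt], by simp [htt]⟩

theorem exists_start {s t : Finset V} (ht : t ∈ T.faces) (hadj : (s ∩ t).card = 2) :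
    ∃ a c x, O a c x ∧ t = {a, c, x} ∧ a ∈ s ∧ c ∈ s := by
  obtain ⟨p, q, hpq, hpq'⟩ := Finset.card_eq_two.1 hadj
  have hp : p ∈ s ∩ t := by simp [hpq']
  have hq : q ∈ s ∩ t := by simp [hpq']
  rw [Finset.mem_inter] at hp hq
  obtain ⟨x, -, -, hx⟩ := Finset.exists_eq_triple_of_card_eq_three (T.card_face t ht) hp.2 hq.2 hpq
  rcases hO.total (hx ▸ ht) with h | h
  · exact ⟨p, q, x, h, hx, hp.1, hq.1⟩
  · exact ⟨q, p, x, h, by rw [hx, Finset.insert_comm], hq.1, hp.1⟩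

/-- Both pairs span the edge common to s and t, and t induces only one direction on it. This is what
closes up the two sides of a strip. -/
theorem eq_of_same_edge {s t : Finset V} (hadj : (s ∩ t).card = 2) {a c x a' c' x' : V}
    (h : O a c x) (h' : O a' c' x') (ht : t = {a, c, x}) (ht' : t = {a', c', x'})
    (ha : a ∈ s) (hc : c ∈ s) (ha' : a' ∈ s) (hc' : c' ∈ s) : a' = a ∧ c' = c := by
  obtain ⟨hac, hax, hcx⟩ := T.ne_of_mem_faces (hO.mem_faces h)
  obtain ⟨hac', hax', hcx'⟩ := T.ne_of_mem_faces (hO.mem_faces h')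
  have hx : x ∉ s := by
    intro hx
    have : ({a, c, x} : Finset V) ⊆ s ∩ t := by
      simp [ha, hc, hx, ht]
    have := Finset.card_le_card this
    rw [T.card_face _ (hO.mem_faces h)] at this
    omega
  have h1 : a' ∈ t := by simp [ht']
  have h2 : c' ∈ t := by simp [ht']
  have h3 : x ∈ t := by simp [ht]
  have h4 := hO.asymm h
  rw [ht, Finset.mem_insert, Finset.mem_insert, Finset.mem_singleton] at h1 h2
  rw [ht', Finset.mem_insert, Finset.mem_insert, Finset.mem_singleton] at h3
  grind

end IsOrientation

end SurfaceTriangulation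

/-! ### Girth of the dual graph -/

namespace SurfaceTriangulation

variable {V : Type u} [Fintype V] [DecidableEq V] {T : SurfaceTriangulation V}

namespace IsOrientation

variable {O : V → V → V → Prop} (hO : T.IsOrientation O)
include hO

/-- In a triangulation with all degrees greater than five, a strip of `k` triangles with
`3 ≤ k ≤ 5`, consecutive ones sharing an edge, does not close up. -/
theorem not_closed_strip (hdeg : ∀ v, 5 < T.oneSkeleton.degree v) {k : ℕ} (hk3 : 3 ≤ k)
    (hk5 : k ≤ 5) (f : ℕ → Finset V) (hf : ∀ i, f i ∈ T.faces)
    (hadj : ∀ i ≤ k, (f i ∩ f (i + 1)).card = 2) (hne : ∀ i ≤ k, f i ≠ f (i + 1))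
    (hne2 : ∀ i < k, f i ≠ f (i + 2)) (h0 : f k = f 0) (h1 : f (k + 1) = f 1) : False := by
  have irr : ∀ {a b}, ¬ O a b a := fun h => (T.ne_of_mem_faces (hO.mem_faces h)).2.1 rfl
  have r2 : ∀ {v a b}, O a v b → ¬ O b v a := fun {v a b} p q =>
    absurd (hdeg v) (not_lt.2 (hO.degree_le_two p q))
  have r3 : ∀ {v a b c}, O a v b → O b v c → ¬ O c v a := fun {v a b c} p q r =>
    absurd (hdeg v) (not_lt.2 (hO.degree_le_three p q r))
  have r4 : ∀ {v a b c d}, O a v b → O b v c → O c v d → ¬ O d v a := fun {v a b c d} p q r s =>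
    absurd (hdeg v) (not_lt.2 (hO.degree_le_four p q r s))
  have r5 : ∀ {v a b c d e}, O a v b → O b v c → O c v d → O d v e → ¬ O e v a :=
    fun {v a b c d e} p q r s t => absurd (hdeg v) (not_lt.2 (hO.degree_le_five p q r s t))
  have step : ∀ i < k, ∀ {a c x}, O a c x → f (i + 1) = {a, c, x} → a ∈ f i → c ∈ f i →
      ∃ a' c' x', ((a' = x ∧ c' = c) ∨ (a' = a ∧ c' = x)) ∧ O a' c' x' ∧
        f (i + 2) = {a', c', x'} ∧ a' ∈ f (i + 1) ∧ c' ∈ f (i + 1) := by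
    intro i hi a c x h ht ha hc
    exact hO.exists_step (hf i) (hf (i + 1)) (hf (i + 2)) (hne i hi.le) (hne2 i hi)
      (hne (i + 1) hi) (hadj (i + 1) hi) h ht ha hc
  obtain ⟨a₀, c₀, x₀, o₀, e₀, m₀, n₀⟩ := hO.exists_start (hf 1) (hadj 0 (Nat.zero_le _))
  have fin : ∀ {a c x}, O a c x → f (k + 1) = {a, c, x} → a ∈ f k → c ∈ f k →
      a = a₀ ∧ c = c₀ := by
    intro a c x h ht ha hc
    exact hO.eq_of_same_edge (hadj 0 (Nat.zero_le _)) o₀ h e₀ (h1 ▸ ht) m₀ n₀ (h0 ▸ ha) (h0 ▸ hc)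
  obtain ⟨a₁, c₁, x₁, s₁, o₁, e₁, m₁, n₁⟩ := step 0 (by omega) o₀ e₀ m₀ n₀
  obtain ⟨a₂, c₂, x₂, s₂, o₂, e₂, m₂, n₂⟩ := step 1 (by omega) o₁ e₁ m₁ n₁
  obtain ⟨a₃, c₃, x₃, s₃, o₃, e₃, m₃, n₃⟩ := step 2 (by omega) o₂ e₂ m₂ n₂
  have cyc := @hO.cyclic
  -- Each step moves one end of the crossing edge and fixes the other, and `fin` returns both ends
  -- to their start. If one side never moves, its vertex has degree at most k; a single move
  -- contradicts `irr`. With two moves on one side, either they are consecutive and the fixed vertex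
  -- opposite contradicts `r2`, or one vertex of that side is encircled by k - 1 of the triangles.
  obtain rfl | hk : k = 3 ∨ 4 ≤ k := by omega
  · have := fin o₃ e₃ m₃ n₃
    clear step fin hO e₀ e₁ e₂ e₃ m₀ m₁ m₂ m₃ n₀ n₁ n₂ n₃ hadj hne hne2 h0 h1 hf hdeg o₃
    rcases s₁ with ⟨rfl, rfl⟩ | ⟨rfl, rfl⟩ <;> rcases s₂ with ⟨rfl, rfl⟩ | ⟨rfl, rfl⟩ <;>
      rcases s₃ with ⟨rfl, rfl⟩ | ⟨rfl, rfl⟩ <;> grind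
  obtain ⟨a₄, c₄, x₄, s₄, o₄, e₄, m₄, n₄⟩ := step 3 (by omega) o₃ e₃ m₃ n₃
  obtain rfl | rfl : k = 4 ∨ k = 5 := by omega
  · have := fin o₄ e₄ m₄ n₄
    clear step fin hO e₀ e₁ e₂ e₃ m₀ m₁ m₂ m₃ n₀ n₁ n₂ n₃ hadj hne hne2 h0 h1 hf hdeg e₄ m₄ n₄ o₄
    rcases s₁ with ⟨rfl, rfl⟩ | ⟨rfl, rfl⟩ <;> rcases s₂ with ⟨rfl, rfl⟩ | ⟨rfl, rfl⟩ <;>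
      rcases s₃ with ⟨rfl, rfl⟩ | ⟨rfl, rfl⟩ <;> rcases s₄ with ⟨rfl, rfl⟩ | ⟨rfl, rfl⟩ <;>
      grind
  obtain ⟨a₅, c₅, x₅, s₅, o₅, e₅, m₅, n₅⟩ := step 4 (by omega) o₄ e₄ m₄ n₄
  have := fin o₅ e₅ m₅ n₅
  clear step fin hO e₀ e₁ e₂ e₃ m₀ m₁ m₂ m₃ n₀ n₁ n₂ n₃ hadj hne hne2 h0 h1 hf hdeg e₄ m₄ n₄ e₅ m₅
    n₅ o₅
  rcases s₁ with ⟨rfl, rfl⟩ | ⟨rfl, rfl⟩ <;> rcases s₂ with ⟨rfl, rfl⟩ | ⟨rfl, rfl⟩ <;>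
    rcases s₃ with ⟨rfl, rfl⟩ | ⟨rfl, rfl⟩ <;> rcases s₄ with ⟨rfl, rfl⟩ | ⟨rfl, rfl⟩ <;>
    rcases s₅ with ⟨rfl, rfl⟩ | ⟨rfl, rfl⟩ <;> grind

end IsOrientation

theorem five_lt_egirth_dualGraph (hT : T.IsOrientable)
    (hdeg : ∀ v, 5 < T.oneSkeleton.degree v) : 5 < T.dualGraph.egirth := by
  obtain ⟨O, hO⟩ := hT.exists_isOrientation
  rw [← ENat.add_one_le_iff (by simp), show (5 : ℕ∞) + 1 = 6 by norm_num,
    SimpleGraph.le_egirth]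
  intro t w hw
  by_contra! hlt
  have hk5 : w.length ≤ 5 := by
    have : w.length < 6 := by exact_mod_cast hlt
    omega
  have hk3 := hw.three_le_length
  set k := w.length with hk
  -- `getVert` is constant beyond the length of the walk, so the cycle is continued by hand one step
  -- past its end.
  let g : ℕ → {t : Finset V // t ∈ T.faces} := fun i => if i ≤ k then w.getVert i else w.getVert 1
  have hg : ∀ i ≤ k, g i = w.getVert i := fun i hi => if_pos hi
  have hgk : g (k + 1) = w.getVert 1 := if_neg (by omega)
  have hend : w.getVert k = w.getVert 0 := by
    rw [hk, w.getVert_length, w.getVert_zero]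
  have hinj := hw.getVert_injOn'
  have hadj : ∀ i ≤ k, T.dualGraph.Adj (g i) (g (i + 1)) := by
    intro i hi
    rcases hi.lt_or_eq with h | rfl
    · rw [hg i hi, hg (i + 1) h]
      exact w.adj_getVert_succ h
    · rw [hg _ le_rfl, hgk, hend]
      exact w.adj_getVert_succ (by omega)
  have hne2 : ∀ i < k, g i ≠ g (i + 2) := by
    intro i hi h
    rcases Nat.lt_or_ge (i + 2) k with h2 | h2
    · rw [hg i (by omega), hg (i + 2) (by omega)] at h
      have := hinj (show i ≤ k - 1 by omega) (show i + 2 ≤ k - 1 by omega) h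
      omega
    · obtain h3 | h3 : i + 2 = k ∨ i + 2 = k + 1 := by omega
      · rw [hg i (by omega), h3, hg k le_rfl, hend] at h
        have := hinj (show i ≤ k - 1 by omega) (show 0 ≤ k - 1 by omega) h
        omega
      · rw [hg i (by omega), h3, hgk] at h
        have := hinj (show i ≤ k - 1 by omega) (show 1 ≤ k - 1 by omega) h
        omega
  refine hO.not_closed_strip hdeg hk3 hk5 (fun i => (g i).1) (fun i => (g i).2)
    (fun i hi => (hadj i hi).2) (fun i hi h => (hadj i hi).1 (Subtype.ext h))
    (fun i hi h => hne2 i hi (Subtype.ext h)) ?_ ?_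
  · simp only [hg k le_rfl, hg 0 (Nat.zero_le _), hend]
  · simp only [hgk, hg 1 (by omega)]

end SurfaceTriangulation

/-! ### Triangulations from rotation systems -/

theorem Finset.triple_rotate {α : Type*} [DecidableEq α] (a b c : α) :
    ({a, b, c} : Finset α) = {b, c, a} := by
  rw [Finset.insert_comm, Finset.pair_comm]

/-- An oriented triangulated surface given by its vertex rotations: `next a b` is the third vertex
of the positively oriented triangle on the directed edge `a b`, and `next a b = a` when `a b` is not
an edge. The vertex `hub` is adjacent to all others. -/
structure RotationSystem (V : Type u) where
  next : V → V → V
  next_self : ∀ a, next a a = a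
  next_next : ∀ a b, next a b ≠ a → next b (next a b) = a
  next_symm : ∀ a b, next a b ≠ a → next b a ≠ b ∧ next b a ≠ next a b
  base : V → V
  base_adj : ∀ v, next v (base v) ≠ v
  exists_iterate : ∀ v x, next v x ≠ v → ∃ k : ℕ, (next v)^[k] (base v) = x
  hub : V
  hub_adj : ∀ v, v ≠ hub → next v hub ≠ v

namespace RotationSystem

variable {V : Type u} (R : RotationSystem V)

/-- `a b c` is a positively oriented triangle. -/
def Pos (a b c : V) : Prop := R.next a b ≠ a ∧ R.next a b = c

variable {R}

theorem Pos.cyclic {a b c : V} (h : R.Pos a b c) : R.Pos b c a := by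
  obtain ⟨h, rfl⟩ := h
  have h1 := R.next_next a b h
  refine ⟨fun h2 => ?_, h1⟩
  rw [h1] at h2
  subst h2
  exact h (R.next_self a)

theorem Pos.ne {a b c : V} (h : R.Pos a b c) : a ≠ b := by
  rintro rfl
  exact h.1 (R.next_self a)

theorem Pos.asymm {a b c : V} (h : R.Pos a b c) : ¬ R.Pos b a c :=
  fun h' => (R.next_symm a b h.1).2 (h'.2.trans h.2.symm)

theorem Pos.unique {a b c d : V} (h : R.Pos a b c) (h' : R.Pos a b d) : c = d :=
  h.2.symm.trans h'.2

theorem Pos.next_symm {a b c : V} (h : R.Pos a b c) : R.Pos b a (R.next b a) :=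
  ⟨(R.next_symm a b h.1).1, rfl⟩

variable [Fintype V] [DecidableEq V] (R)

def faces : Finset (Finset V) :=
  (Finset.univ.filter fun p : V × V => R.next p.1 p.2 ≠ p.1).image
    fun p => {p.1, p.2, R.next p.1 p.2}

variable {R}

theorem exists_pos_of_mem_faces {t : Finset V} (h : t ∈ R.faces) :
    ∃ a b c, R.Pos a b c ∧ t = {a, b, c} := by
  obtain ⟨p, hp, rfl⟩ := Finset.mem_image.1 h
  exact ⟨p.1, p.2, _, ⟨(Finset.mem_filter.1 hp).2, rfl⟩, rfl⟩

theorem Pos.mem_faces {a b c : V} (h : R.Pos a b c) : {a, b, c} ∈ R.faces :=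
  Finset.mem_image.2 ⟨(a, b), Finset.mem_filter.2 ⟨Finset.mem_univ _, h.1⟩, by rw [← h.2]⟩

theorem card_face {t : Finset V} (h : t ∈ R.faces) : t.card = 3 := by
  obtain ⟨a, b, c, hp, rfl⟩ := exists_pos_of_mem_faces h
  exact Finset.card_eq_three.2 ⟨a, b, c, hp.ne, hp.cyclic.cyclic.ne.symm, hp.cyclic.ne, rfl⟩

theorem mem_faces_iff {a b c : V} : {a, b, c} ∈ R.faces ↔ R.Pos a b c ∨ R.Pos b a c := by
  refine ⟨fun h => ?_, ?_⟩
  · obtain ⟨hab, hac, hbc⟩ := Finset.ne_of_card_triple (card_face h)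
    obtain ⟨x, y, z, hp, he⟩ := exists_pos_of_mem_faces h
    have ha : a ∈ ({x, y, z} : Finset V) := by simp [← he]
    have hb : b ∈ ({x, y, z} : Finset V) := by simp [← he]
    have hc : c ∈ ({x, y, z} : Finset V) := by simp [← he]
    simp only [Finset.mem_insert, Finset.mem_singleton] at ha hb hc
    have h1 := hp.cyclic
    have h2 := h1.cyclic
    grind
  · rintro (h | h)
    · exact h.mem_faces
    · rw [Finset.insert_comm]
      exact h.mem_faces

theorem exists_eq_triple {t : Finset V} (ht : t ∈ R.faces) {a b : V} (ha : a ∈ t) (hb : b ∈ t)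
    (hab : a ≠ b) : ∃ c, t = {a, b, c} ∧ (R.Pos a b c ∨ R.Pos b a c) := by
  obtain ⟨c, -, -, rfl⟩ := Finset.exists_eq_triple_of_card_eq_three (card_face ht) ha hb hab
  exact ⟨c, rfl, mem_faces_iff.1 ht⟩

/-- The positive triangle on a b may be the one across the edge from t. -/
theorem pos_of_mem {t : Finset V} (ht : t ∈ R.faces) {a b : V} (ha : a ∈ t) (hb : b ∈ t)
    (hab : a ≠ b) : R.Pos a b (R.next a b) := by
  obtain ⟨c, -, h | h⟩ := exists_eq_triple ht ha hb hab
  · exact ⟨h.1, rfl⟩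
  · exact h.next_symm

variable (R)

/-- The two triangles on an edge a b have third vertices `next a b` and `next b a`, distinct by
`next_symm`. Iterating `next v` from `base v` traverses the link of v, and the surface is connected
through the hub. -/
def toTriangulation : SurfaceTriangulation V where
  faces := R.faces
  card_face _ := card_face
  exists_face v :=
    ⟨_, Pos.mem_faces ⟨R.base_adj v, rfl⟩, by simp⟩
  card_faces_of_edge t ht e het he := by
    obtain ⟨a, b, hab, rfl⟩ := Finset.card_eq_two.1 he
    have h1 : R.Pos a b (R.next a b) := pos_of_mem ht (het (by simp)) (het (by simp)) hab
    have h2 := h1.next_symm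
    rw [Finset.card_eq_two]
    refine ⟨{a, b, R.next a b}, {a, b, R.next b a}, fun h => ?_, ?_⟩
    · have : R.next b a ∈ ({a, b, R.next a b} : Finset V) := by rw [h]; simp
      have h3 := (R.next_symm a b h1.1).2
      have h4 := h2.cyclic.ne
      simp only [Finset.mem_insert, Finset.mem_singleton] at this
      exact this.elim (fun h => h4 h.symm) (fun h => h.elim h2.1 h3)
    · ext s
      simp only [Finset.mem_filter, Finset.mem_insert, Finset.mem_singleton]
      constructor
      · rintro ⟨hs, hes⟩
        obtain ⟨c, rfl, h | h⟩ := exists_eq_triple hs (hes (by simp : a ∈ _))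
          (hes (by simp : b ∈ _)) hab
        · exact Or.inl (by rw [h.2])
        · exact Or.inr (by rw [h.2])
      · rintro (rfl | rfl)
        · exact ⟨h1.mem_faces, by simp [Finset.insert_subset_iff]⟩
        · exact ⟨mem_faces_iff.2 (Or.inr h2), by simp [Finset.insert_subset_iff]⟩
  link_connected v a b hav hbv ha hb := by
    have key : ∀ k : ℕ, R.next v ((R.next v)^[k] (R.base v)) ≠ v ∧
        Relation.ReflTransGen (fun x y : V => ({v, x, y} : Finset V) ∈ R.faces)
          (R.base v) ((R.next v)^[k] (R.base v)) := by
      intro k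
      induction k with
      | zero => exact ⟨R.base_adj v, .refl⟩
      | succ k ih =>
        rw [Function.iterate_succ_apply']
        have hp : R.Pos v ((R.next v)^[k] (R.base v)) _ := ⟨ih.1, rfl⟩
        exact ⟨hp.cyclic.cyclic.next_symm.1, ih.2.tail hp.mem_faces⟩
    have from_base : ∀ {x}, x ≠ v → (∃ t ∈ R.faces, v ∈ t ∧ x ∈ t) →
        Relation.ReflTransGen (fun x y : V => ({v, x, y} : Finset V) ∈ R.faces) (R.base v) x := by
      rintro x hxv ⟨t, ht, hv, hx⟩
      obtain ⟨k, rfl⟩ := R.exists_iterate v x (pos_of_mem ht hv hx hxv.symm).1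
      exact (key k).2
    have : Std.Symm fun x y : V => ({v, x, y} : Finset V) ∈ R.faces :=
      ⟨fun x y h => by rwa [Finset.pair_comm]⟩
    exact .trans (Relation.ReflTransGen.stdSymm.symm _ _ (from_base hav ha)) (from_base hbv hb)
  nonempty := ⟨R.hub⟩
  connected a b := by
    have h : ∀ v, v ≠ R.hub → ∃ t ∈ R.faces, v ∈ t ∧ R.hub ∈ t := fun v hv =>
      ⟨_, Pos.mem_faces ⟨R.hub_adj v hv, rfl⟩, by simp, by simp⟩
    have h1 : Relation.ReflTransGen (fun x y : V => ∃ t ∈ R.faces, x ∈ t ∧ y ∈ t) a R.hub := by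
      by_cases ha : a = R.hub
      · rw [ha]
      · exact .single (h a ha)
    refine h1.trans ?_
    by_cases hb : b = R.hub
    · rw [hb]
    · obtain ⟨t, ht, h1, h2⟩ := h b hb
      exact .single ⟨t, ht, h2, h1⟩

theorem toTriangulation_isOrientable : R.toTriangulation.IsOrientable := by
  refine ⟨R.Pos, fun _ _ _ h => h.cyclic, fun a b c h => ⟨Pos.asymm, fun h' => ?_⟩,
    fun a b c d hcd hc hd => ⟨fun h => ?_, fun h => ?_⟩⟩
  · exact (mem_faces_iff.1 h).resolve_right h'
  · exact (mem_faces_iff.1 hd).resolve_left fun h' => hcd (h.unique h')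
  · exact (mem_faces_iff.1 hc).resolve_right fun h' => hcd (h'.unique h)

theorem degree_toTriangulation (v : V) : R.toTriangulation.oneSkeleton.degree v =
    (Finset.univ.filter fun x => R.next v x ≠ v).card := by
  rw [← SimpleGraph.card_neighborFinset_eq_degree]
  congr 1
  ext x
  rw [SimpleGraph.mem_neighborFinset, Finset.mem_filter]
  constructor
  · rintro ⟨hne, t, ht, hv, hx⟩
    exact ⟨Finset.mem_univ _, (pos_of_mem ht hv hx hne).1⟩
  · rintro ⟨-, h⟩
    have hp : R.Pos v x _ := ⟨h, rfl⟩
    exact ⟨hp.ne, _, hp.mem_faces, by simp, by simp⟩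

/-- The triangles meeting `I` are among those on a set `S` of directed edges, if every directed edge
starting in `I` can be rotated within its triangle into `S`. -/
theorem card_faces_meeting_le (I : Finset V) (S : Finset (V × V))
    (h : ∀ a ∈ I, ∀ b, R.next a b ≠ a → (a, b) ∈ S ∨ (b, R.next a b) ∈ S ∨ (R.next a b, a) ∈ S) :
    (R.faces.filter fun t => (t ∩ I).Nonempty).card ≤ S.card := by
  refine (Finset.card_le_card fun t ht => ?_).trans
    (Finset.card_image_le (s := S) (f := fun p => {p.1, p.2, R.next p.1 p.2}))
  obtain ⟨ht, a, ha⟩ := Finset.mem_filter.1 ht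
  obtain ⟨hat, haI⟩ := Finset.mem_inter.1 ha
  have key : ∀ x y z, R.Pos x y z → (x, y) ∈ S → ({x, y, z} : Finset V) ∈
      S.image (fun p => {p.1, p.2, R.next p.1 p.2}) := fun x y z hp hS =>
    Finset.mem_image.2 ⟨_, hS, by rw [← hp.2]⟩
  obtain ⟨b, c, hp, rfl⟩ : ∃ b c, R.Pos a b c ∧ t = {a, b, c} := by
    obtain ⟨x, y, z, hp, rfl⟩ := exists_pos_of_mem_faces ht
    simp only [Finset.mem_insert, Finset.mem_singleton] at hat
    rcases hat with rfl | rfl | rfl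
    · exact ⟨_, _, hp, rfl⟩
    · exact ⟨_, _, hp.cyclic, Finset.triple_rotate _ _ _⟩
    · exact ⟨_, _, hp.cyclic.cyclic, (Finset.triple_rotate _ _ _).symm⟩
  have hn := hp.2
  rcases h a haI b hp.1 with hS | hS | hS
  · exact key _ _ _ hp hS
  · rw [hn] at hS
    rw [Finset.triple_rotate]
    exact key _ _ _ hp.cyclic hS
  · rw [hn] at hS
    rw [← Finset.triple_rotate]
    exact key _ _ _ hp.cyclic.cyclic hS

end RotationSystem

/-! ### The two explicit surfaces -/

/-- Möbius' seven-vertex torus. -/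
def moebiusTorus : RotationSystem (Fin 7) where
  -- The table is multiplication by 3 modulo 7. As 3 is a primitive root, the six neighbours form
  -- one cycle; `next_next` holds because 1 - 3 + 9 = 7.
  next a b := a + ![0, 3, 6, 2, 5, 1, 4] (b - a)
  next_self := by decide
  next_next := by decide
  next_symm := by decide
  base a := a + 1
  base_adj := by decide
  exists_iterate v x h := by
    -- Bounding the exponent makes the statement decidable.
    have : ∀ v x : Fin 7, v + ![0, 3, 6, 2, 5, 1, 4] (x - v) ≠ v →
      ∃ k : Fin 7, (fun b => v + ![0, 3, 6, 2, 5, 1, 4] (b - v))^[k.1] (v + 1) = x := by decide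
    exact (this v x h).imp' _ fun _ => id
  hub := 0
  hub_adj := by decide

/-- The successor table of a triangulation of the surface of genus seven: the vertices `13, …, 16`
together with `0`, `1`, `5` carry a seven-vertex torus minus a triangle, which is glued to a
triangulation of the surface of genus six with vertices `0, …, 12` minus the triangle `0 1 5`. -/
def genusSevenNext (a b : Fin 17) : Fin 17 :=
  (![
    ![0, 14, 3, 1, 10, 6, 9, 0, 4, 8, 12, 0, 2, 16, 15, 13, 5],
    ![3, 1, 10, 6, 11, 13, 7, 4, 2, 1, 5, 8, 1, 15, 0, 16, 14],
    ![12, 8, 2, 0, 7, 4, 2, 10, 9, 11, 1, 3, 5, 2, 2, 2, 2],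
    ![2, 0, 11, 3, 12, 10, 1, 8, 5, 7, 6, 4, 9, 3, 3, 3, 3],
    ![8, 7, 5, 11, 4, 9, 4, 2, 12, 10, 0, 1, 3, 4, 4, 4, 4],
    ![16, 10, 12, 8, 2, 5, 0, 9, 11, 4, 3, 7, 6, 1, 13, 14, 15],
    ![5, 3, 6, 10, 6, 12, 6, 1, 7, 0, 9, 6, 8, 6, 6, 6, 6],
    ![7, 6, 4, 9, 1, 11, 8, 7, 3, 5, 2, 12, 10, 7, 7, 7, 7],
    ![9, 11, 1, 7, 0, 3, 12, 6, 8, 2, 8, 5, 4, 8, 8, 8, 8],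
    ![6, 9, 8, 12, 5, 7, 10, 3, 0, 9, 4, 2, 11, 9, 9, 9, 9],
    ![4, 2, 7, 5, 9, 1, 3, 12, 10, 6, 10, 10, 0, 10, 10, 10, 10],
    ![11, 4, 9, 2, 3, 8, 11, 5, 1, 12, 11, 11, 7, 11, 11, 11, 11],
    ![10, 12, 0, 4, 8, 2, 5, 11, 6, 3, 7, 9, 12, 12, 12, 12, 12],
    ![15, 5, 13, 13, 13, 14, 13, 13, 13, 13, 13, 13, 13, 13, 16, 1, 0],
    ![1, 16, 14, 14, 14, 15, 14, 14, 14, 14, 14, 14, 14, 5, 14, 0, 13],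
    ![14, 13, 15, 15, 15, 16, 15, 15, 15, 15, 15, 15, 15, 0, 5, 15, 1],
    ![13, 15, 16, 16, 16, 0, 16, 16, 16, 16, 16, 16, 16, 14, 1, 5, 16]] : Fin 17 → Fin 17 → Fin 17) a b

def genusSevenSurface : RotationSystem (Fin 17) where
  next := genusSevenNext
  next_self := by decide
  next_next := by decide
  next_symm := by decide
  base a := if a = 5 then 0 else 5
  base_adj := by decide
  exists_iterate v x h := by
    have : ∀ v x : Fin 17, genusSevenNext v x ≠ v →
      ∃ k : Fin 17, (genusSevenNext v)^[k.1] (if v = 5 then 0 else 5) = x := by decide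
    exact (this v x h).imp' _ fun _ => id
  hub := 5
  hub_adj := by decide

theorem moebiusTorus_isRegularOfDegree :
    moebiusTorus.toTriangulation.oneSkeleton.IsRegularOfDegree 6 := by
  intro v
  rw [RotationSystem.degree_toTriangulation]
  revert v
  decide

theorem five_lt_degree_genusSevenSurface (v : Fin 17) :
    5 < genusSevenSurface.toTriangulation.oneSkeleton.degree v := by
  rw [RotationSystem.degree_toTriangulation]
  revert v
  decide

theorem not_luoCondition_genusSevenSurface :
    ¬ genusSevenSurface.toTriangulation.LuoCondition := by
  intro h
  have h1 := genusSevenSurface.toTriangulation.sum_degree_eq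
  simp_rw [RotationSystem.degree_toTriangulation] at h1
  rw [show ∑ v : Fin 17, (Finset.univ.filter fun x => genusSevenSurface.next v x ≠ v).card = 174
    by decide] at h1
  -- One directed edge for each of the 13 triangles of the torus patch; the contradiction is 13/4 <
  -- 58/17.
  have h2 := genusSevenSurface.card_faces_meeting_le {13, 14, 15, 16}
    {(13, 0), (13, 1), (13, 5), (13, 14), (13, 15), (13, 16), (14, 0), (14, 1), (14, 5),
      (14, 15), (15, 5), (15, 16), (16, 5)}
    (by decide)
  have h3 := h {13, 14, 15, 16} ⟨13, by decide⟩ (by decide)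
  have h4 : genusSevenSurface.toTriangulation.faces.card = 58 := by omega
  have h5 : ((genusSevenSurface.toTriangulation.faces.filter
      fun t => (t ∩ {13, 14, 15, 16}).Nonempty).card : ℝ) ≤ 13 := by
    exact_mod_cast h2
  rw [h4, show ({13, 14, 15, 16} : Finset (Fin 17)).card = 4 by decide, Fintype.card_fin,
    gt_iff_lt, div_lt_div_iff₀ (by norm_num) (by norm_num)] at h3
  push_cast at h3
  linarith

theorem corollary3 :
    -- vertex degrees greater than 5: the density condition always holds on the dual graph
    (∀ (V : Type u) [Fintype V] [DecidableEq V] (T : SurfaceTriangulation V) (l : T.PLMetric),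
      l.IsDelaunay → (∀ v : V, 5 < T.oneSkeleton.degree v) →
        T.dualGraph.Connected ∧
        T.dualGraph.IsRegularOfDegree 3 ∧
        (T.IsOrientable → 5 < T.dualGraph.egirth) ∧
        T.dualGraph.DensityCondition) ∧
    -- but Luo's condition may fail on the triangulation
    (∃ (n : ℕ) (T : SurfaceTriangulation (Fin n)) (l : T.PLMetric),
      T.IsOrientable ∧ l.IsStrictlyDelaunay ∧ (∀ v, 5 < T.oneSkeleton.degree v) ∧
        T.dualGraph.DensityCondition ∧ ¬ T.LuoCondition) ∧
    -- 6-regular triangulations: both conditions hold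
    (∀ (V : Type u) [Fintype V] [DecidableEq V] (T : SurfaceTriangulation V) (l : T.PLMetric),
      l.IsDelaunay → T.oneSkeleton.IsRegularOfDegree 6 →
        T.eulerChar = 0 ∧ T.LuoCondition ∧ T.dualGraph.DensityCondition) ∧
    -- and such triangulations exist (on the torus)
    (∃ (n : ℕ) (T : SurfaceTriangulation (Fin n)) (l : T.PLMetric),
      T.IsOrientable ∧ l.IsStrictlyDelaunay ∧ T.oneSkeleton.IsRegularOfDegree 6) := by

  refine ⟨fun V _ _ T _ _ hdeg => ⟨T.dualGraph_connected, T.dualGraph_isRegularOfDegree,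
      fun hT => SurfaceTriangulation.five_lt_egirth_dualGraph hT hdeg,
      T.dualGraph_densityCondition⟩,
    ⟨17, genusSevenSurface.toTriangulation, SurfaceTriangulation.equilateral _,
      genusSevenSurface.toTriangulation_isOrientable,
      SurfaceTriangulation.equilateral_isStrictlyDelaunay _, five_lt_degree_genusSevenSurface,
      SurfaceTriangulation.dualGraph_densityCondition _, not_luoCondition_genusSevenSurface⟩,
    fun V _ _ T _ _ h => ⟨T.eulerChar_eq_zero_of_isRegularOfDegree_six h,
      T.luoCondition_of_isRegularOfDegree h, T.dualGraph_densityCondition⟩,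
    ⟨7, moebiusTorus.toTriangulation, SurfaceTriangulation.equilateral _,
      moebiusTorus.toTriangulation_isOrientable,
      SurfaceTriangulation.equilateral_isStrictlyDelaunay _, moebiusTorus_isRegularOfDegree⟩⟩
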